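/- Let $n\ge 1$ and let $V\in L^\infty_{loc}(\mathbb R^n)$ be real-valued. Assume that there is some $r>0$ such that $V\ge 0$ almost everywhere on $\{|x|>r\}$, $$\int_{|x|>r}\frac{1}{|x|^{n+2}\,V(x)}\,dx<\infty\qquad\text{and}\qquad \int_{|x|>r}|x|^{4-2n}\,V(x)\,dx=\infty ,$$ where $1/0=\infty$. A weak solution of $-\Delta u=Vu$ on $\mathbb R^n$ is a real-valued function $u\in L^1_{loc}(\mathbb R^n)$ with $Vu\in L^1_{loc}(\mathbb R^n)$ and $-\int_{\mathbb R^n} u\,\Delta\varphi\,dx=\int_{\mathbb R^n} V u\,\varphi\,dx$ for all $\varphi\in C_c^\infty(\mathbb R^n)$. Then: 1. If $u\in L^\infty(\mathbb R^n)$ is a weak solution of $-\Delta u=Vu$ on $\mathbb R^n$, and there is $R$ such that $u\ge 0$ a.e. on $\{|x|>R\}$ or $u\le 0$ a.e. on $\{|x|>R\}$, then $u=0$ a.e. on $\mathbb R^n$. 2. Consequently every weak solution $u\in L^\infty(\mathbb R^n)$ of $-\Delta u=Vu$ on $\mathbb R^n$ that is not a.e. equal to a constant changes sign near infinity: for every $R$,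 both $\{|x|>R,\ u>0\}$ and $\{|x|>R,\ u<0\}$ have positive measure. -/

import Mathlib

open MeasureTheory

open scoped ContDiff

/-- `f ∈ L^∞_loc(ℝⁿ)`: measurable (up to null sets) and essentially bounded on every compact set. -/
def IsLinftyLoc {n : ℕ} (f : EuclideanSpace ℝ (Fin n) → ℝ) : Prop :=
  AEStronglyMeasurable f volume ∧
    ∀ K : Set (EuclideanSpace ℝ (Fin n)), IsCompact K → MemLp f ⊤ (volume.restrict K)

/-- `u` is a weak (distributional) solution of `-Δ u = V u` on `ℝⁿ`: both `u` and `V u` are locally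
integrable, and the equation holds when tested against every `φ ∈ C_c^∞(ℝⁿ)`. -/
structure IsWeakSolution {n : ℕ} (V u : EuclideanSpace ℝ (Fin n) → ℝ) : Prop where
  locallyIntegrable : LocallyIntegrable u volume
  locallyIntegrable_mul : LocallyIntegrable (fun x => V x * u x) volume
  weak_eq : ∀ φ : EuclideanSpace ℝ (Fin n) → ℝ, ContDiff ℝ ∞ φ → HasCompactSupport φ →
    -(∫ x, u x * Laplacian.laplacian φ x) = ∫ x, V x * u x * φ x

/-- `f ≥ 0` (a.e.) when `|x|` is large. -/
def NonnegNearInfinity {n : ℕ} (f : EuclideanSpace ℝ (Fin n) → ℝ) : Prop :=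
  ∃ R : ℝ, ∀ᵐ x, R < ‖x‖ → 0 ≤ f x

/-- `f ≤ 0` (a.e.) when `|x|` is large. -/
def NonposNearInfinity {n : ℕ} (f : EuclideanSpace ℝ (Fin n) → ℝ) : Prop :=
  ∃ R : ℝ, ∀ᵐ x, R < ‖x‖ → f x ≤ 0

/-- `f` changes sign near infinity: outside every ball it is positive on a set of positive measure
and negative on a set of positive measure. -/
def ChangesSignNearInfinity {n : ℕ} (f : EuclideanSpace ℝ (Fin n) → ℝ) : Prop :=
  ∀ R : ℝ, 0 < volume {x : EuclideanSpace ℝ (Fin n) | R < ‖x‖ ∧ 0 < f x} ∧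
    0 < volume {x : EuclideanSpace ℝ (Fin n) | R < ‖x‖ ∧ f x < 0}

open Filter Topology Metric Set

/-! After replacing `u` by `-u` if necessary, let `u ≥ 0` near infinity. Far out `V ≥ 0` as well, so
`u` is a nonnegative supersolution there. Fix `x₀` far away and `s = |x₀| / 10`.

The weak Harnack inequality (`exists_weak_harnack`) bounds `u` below on `B(x₀, s)` by a multiple of
`s⁻ⁿ ∫_{B(x₀,2s)} u`. Testing the equation with a bump at scale `s` bounds `∫_{B(x₀,s/2)} V u` above
by a multiple of `s⁻² ∫_{B(x₀,2s)} u`. If the last integral is positive it cancels, leaving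
`∫_{B(x₀,s/2)} V ≤ C sⁿ⁻²` (`exists_integral_potential_le`). Cauchy-Schwarz for `1 = V^{1/2}
V^{-1/2}` then bounds the integral of `1 / (|x|ⁿ⁺² V)` over `B(x₀, s/2)` below by a fixed positive
constant. This contradicts convergence of the integral once `x₀` is far enough, so `u` vanishes near
infinity.

A bounded compactly supported solution is zero by a Carleman estimate with linear weight. For `v =
e^{a·x} u` and `q = e^{a·x} V u`, the Fourier symbol of the conjugated Laplacian has imaginary part
of size `4π |a·ξ|`. This controls the difference of `v` and a translate along `a`. When the
translation separates the supports, that difference dominates `v` in `L²`; a large weight gives `‖v‖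
≤ ‖v‖ / 2`. -/

/-! ### The Laplacian of radial functions and of exponentials -/

/-- The Laplacian as the trace of a second derivative. -/
theorem laplacian_eq_sum_of_hasFDerivAt {n : ℕ} {F : Type*} [NormedAddCommGroup F]
    [NormedSpace ℝ F] {f : EuclideanSpace ℝ (Fin n) → F}
    {f' : EuclideanSpace ℝ (Fin n) → EuclideanSpace ℝ (Fin n) →L[ℝ] F}
    {f'' : EuclideanSpace ℝ (Fin n) →L[ℝ] EuclideanSpace ℝ (Fin n) →L[ℝ] F}
    {x : EuclideanSpace ℝ (Fin n)} (hf : ∀ y, HasFDerivAt f (f' y) y)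
    (hf' : HasFDerivAt f' f'' x) :
    Laplacian.laplacian f x = ∑ i, f'' (EuclideanSpace.basisFun (Fin n) ℝ i)
      (EuclideanSpace.basisFun (Fin n) ℝ i) := by
  rw [InnerProductSpace.laplacian_eq_iteratedFDeriv_orthonormalBasis f
    (EuclideanSpace.basisFun (Fin n) ℝ)]
  have h : fderiv ℝ f = f' := funext fun y => (hf y).fderiv
  simp [iteratedFDeriv_two_apply, h, hf'.fderiv]

theorem hasFDerivAt_norm_sub_sq {n : ℕ} (x y : EuclideanSpace ℝ (Fin n)) :
    HasFDerivAt (fun z => ‖z - x‖ ^ 2) ((2 : ℝ) • innerSL ℝ (y - x)) y := by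
  have h := ((hasStrictFDerivAt_norm_sq (y - x)).hasFDerivAt).comp y ((hasFDerivAt_id y).sub_const x)
  simpa [Function.comp_def, two_smul] using h

theorem laplacian_comp_norm_sub_sq {n : ℕ} {F F' F'' : ℝ → ℝ} (hF : ∀ t, HasDerivAt F (F' t) t)
    (hF' : ∀ t, HasDerivAt F' (F'' t) t) (x y : EuclideanSpace ℝ (Fin n)) :
    Laplacian.laplacian (fun z => F (‖z - x‖ ^ 2)) y =
      2 * n * F' (‖y - x‖ ^ 2) + 4 * ‖y - x‖ ^ 2 * F'' (‖y - x‖ ^ 2) := by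
  have h1 : ∀ z, HasFDerivAt (fun z => F (‖z - x‖ ^ 2))
      ((2 * F' (‖z - x‖ ^ 2)) • innerSL ℝ (z - x)) z := fun z => by
    have := (hF (‖z - x‖ ^ 2)).comp_hasFDerivAt z (hasFDerivAt_norm_sub_sq x z)
    simpa [Function.comp_def, smul_smul, mul_comm] using this
  have h2 : HasFDerivAt (fun z => (2 * F' (‖z - x‖ ^ 2)) • innerSL ℝ (z - x)) _ y :=
    (((hF' (‖y - x‖ ^ 2)).comp_hasFDerivAt y (hasFDerivAt_norm_sub_sq x y)).const_mul 2).smul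
      ((innerSL ℝ).hasFDerivAt.comp y ((hasFDerivAt_id y).sub_const x))
  rw [laplacian_eq_sum_of_hasFDerivAt h1 h2]
  have h3 : ‖y - x‖ ^ 2 = ∑ i, (y i - x i) ^ 2 := by
    rw [EuclideanSpace.real_norm_sq_eq]; simp
  have h4 : ∀ i : Fin n, inner ℝ (y - x) (EuclideanSpace.single i (1 : ℝ)) = y i - x i := by
    intro i; simp [EuclideanSpace.inner_single_right]
  simp only [EuclideanSpace.basisFun_apply, add_apply,
    smul_apply, ContinuousLinearMap.smulRight_apply, innerSL_apply_apply,
    ContinuousLinearMap.comp_apply, ContinuousLinearMap.id_apply, smul_eq_mul, h4,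
    Function.comp_apply]
  rw [Finset.sum_add_distrib]
  congr 1
  · have h5 : ∀ i : Fin n, innerSL ℝ (EuclideanSpace.single i (1 : ℝ))
        (EuclideanSpace.single i (1 : ℝ)) = 1 := fun i => by
      rw [innerSL_apply_apply]
      simp
    simp only [h5, mul_one, Finset.sum_const, Finset.card_univ, Fintype.card_fin, nsmul_eq_mul]
    ring
  · nth_rewrite 2 [h3]
    rw [Finset.mul_sum, Finset.sum_mul]
    exact Finset.sum_congr rfl fun i _ => by ring

theorem laplacian_cexp_clm {n : ℕ} (ℓ : EuclideanSpace ℝ (Fin n) →L[ℝ] ℂ)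
    (x : EuclideanSpace ℝ (Fin n)) :
    Laplacian.laplacian (fun z => Complex.exp (ℓ z)) x =
      (∑ i, ℓ (EuclideanSpace.single i 1) ^ 2) * Complex.exp (ℓ x) := by
  have h1 : ∀ z, HasFDerivAt (fun z => Complex.exp (ℓ z)) (Complex.exp (ℓ z) • ℓ) z :=
    fun z => ℓ.hasFDerivAt.cexp
  have h2 : HasFDerivAt (fun z => Complex.exp (ℓ z) • ℓ) _ x := (h1 x).smul_const ℓ
  rw [laplacian_eq_sum_of_hasFDerivAt h1 h2, Finset.sum_mul]
  refine Finset.sum_congr rfl fun i _ => ?_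
  simp
  ring

/-! ### The bump profile and its derivatives -/

/-- The first derivative of `expNegInvGlue`. -/
noncomputable def glueDeriv (t : ℝ) : ℝ := t⁻¹ ^ 2 * expNegInvGlue t

/-- The second derivative of `expNegInvGlue`. -/
noncomputable def glueDerivTwo (t : ℝ) : ℝ := t⁻¹ ^ 2 * (t⁻¹ ^ 2 - 2 * t⁻¹) * expNegInvGlue t

theorem hasDerivAt_expNegInvGlue (t : ℝ) : HasDerivAt expNegInvGlue (glueDeriv t) t := by
  simpa [glueDeriv] using expNegInvGlue.hasDerivAt_polynomial_eval_inv_mul 1 t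

theorem hasDerivAt_glueDeriv (t : ℝ) : HasDerivAt glueDeriv (glueDerivTwo t) t := by
  have := expNegInvGlue.hasDerivAt_polynomial_eval_inv_mul (Polynomial.X ^ 2) t
  simp only [Polynomial.eval_pow, Polynomial.eval_X] at this
  refine HasDerivAt.congr_deriv this ?_
  simp [glueDerivTwo, one_add_one_eq_two]

theorem continuous_glueDeriv : Continuous glueDeriv :=
  continuous_iff_continuousAt.2 fun t => (hasDerivAt_glueDeriv t).continuousAt

theorem continuous_glueDerivTwo : Continuous glueDerivTwo := by
  have := expNegInvGlue.continuous_polynomial_eval_inv_mul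
    (Polynomial.X ^ 2 * (Polynomial.X ^ 2 - 2 * Polynomial.X))
  exact this.congr fun t => by simp [glueDerivTwo]

theorem glueDeriv_of_nonpos {t : ℝ} (ht : t ≤ 0) : glueDeriv t = 0 := by
  simp [glueDeriv, expNegInvGlue.zero_of_nonpos ht]

theorem glueDerivTwo_of_nonpos {t : ℝ} (ht : t ≤ 0) : glueDerivTwo t = 0 := by
  simp [glueDerivTwo, expNegInvGlue.zero_of_nonpos ht]

theorem glueDeriv_nonneg (t : ℝ) : 0 ≤ glueDeriv t :=
  mul_nonneg (sq_nonneg _) (expNegInvGlue.nonneg t)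

theorem glueDeriv_pos {t : ℝ} (ht : 0 < t) : 0 < glueDeriv t :=
  mul_pos (by positivity) (expNegInvGlue.pos_of_pos ht)

/-- Only `t ≤ 1` matters, since the profile is always evaluated at `1 - |y - x|² / δ²`. -/
theorem exists_bound_glueDeriv :
    ∃ M : ℝ, 0 < M ∧ ∀ t ≤ 1, |glueDeriv t| ≤ M ∧ |glueDerivTwo t| ≤ M := by
  obtain ⟨A, hA⟩ := isCompact_Icc.exists_bound_of_continuousOn (s := Icc (0 : ℝ) 1)
    continuous_glueDeriv.continuousOn
  obtain ⟨B, hB⟩ := isCompact_Icc.exists_bound_of_continuousOn (s := Icc (0 : ℝ) 1)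
    continuous_glueDerivTwo.continuousOn
  refine ⟨max 1 (max A B), by positivity, fun t ht => ?_⟩
  rcases le_total t 0 with h | h
  · simp [glueDeriv_of_nonpos h, glueDerivTwo_of_nonpos h]
  · exact ⟨(hA t ⟨h, ht⟩).trans (by simp), (hB t ⟨h, ht⟩).trans (by simp)⟩

/-- The endpoint is `7/16 = 1 - (3/4)²`: in the weak Harnack inequality the kernel of radius `4s` is
bounded below at distance at most `3s` from its centre. -/
theorem exists_pos_le_glueDeriv : ∃ m : ℝ, 0 < m ∧ ∀ t ∈ Icc (7 / 16 : ℝ) 1, m ≤ glueDeriv t := by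
  obtain ⟨t, ht, hmin⟩ := isCompact_Icc.exists_isMinOn (s := Icc (7 / 16 : ℝ) 1)
    ⟨1, by norm_num⟩ continuous_glueDeriv.continuousOn
  exact ⟨glueDeriv t, glueDeriv_pos (by linarith [ht.1]), fun s hs => hmin hs⟩

/-! ### Radial test functions and averaging kernels -/

/-- A smooth radial bump supported in the closed ball of centre `x` and radius `δ`. -/
noncomputable def radialBump {n : ℕ} (x : EuclideanSpace ℝ (Fin n)) (δ : ℝ)
    (y : EuclideanSpace ℝ (Fin n)) : ℝ :=
  expNegInvGlue (1 - ‖y - x‖ ^ 2 / δ ^ 2)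

/-- The averaging kernel whose derivative in the radius is a multiple of the Laplacian of
`radialBump`. -/
noncomputable def radialKernel {n : ℕ} (x : EuclideanSpace ℝ (Fin n)) (δ : ℝ)
    (y : EuclideanSpace ℝ (Fin n)) : ℝ :=
  (δ ^ n)⁻¹ * glueDeriv (1 - ‖y - x‖ ^ 2 / δ ^ 2)

section

variable {n : ℕ} {x y : EuclideanSpace ℝ (Fin n)} {δ : ℝ}

theorem contDiff_radialBump (x : EuclideanSpace ℝ (Fin n)) (δ : ℝ) :
    ContDiff ℝ ∞ (radialBump x δ) := by
  refine expNegInvGlue.contDiff.comp (contDiff_const.sub ?_)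
  exact ((contDiff_id.sub contDiff_const).norm_sq ℝ).div_const _

theorem radialBump_nonneg : 0 ≤ radialBump x δ y := expNegInvGlue.nonneg _

theorem one_sub_div_nonpos (hδ : 0 < δ) (hy : y ∉ ball x δ) : 1 - ‖y - x‖ ^ 2 / δ ^ 2 ≤ 0 := by
  rw [mem_ball_iff_norm, not_lt] at hy
  rw [sub_nonpos, one_le_div (by positivity)]
  gcongr

theorem radialBump_of_notMem (hδ : 0 < δ) (hy : y ∉ ball x δ) : radialBump x δ y = 0 :=
  expNegInvGlue.zero_of_nonpos (one_sub_div_nonpos hδ hy)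

theorem radialKernel_of_notMem (hδ : 0 < δ) (hy : y ∉ ball x δ) : radialKernel x δ y = 0 := by
  rw [radialKernel, glueDeriv_of_nonpos (one_sub_div_nonpos hδ hy), mul_zero]

theorem radialKernel_nonneg (hδ : 0 < δ) : 0 ≤ radialKernel x δ y :=
  mul_nonneg (by positivity) (glueDeriv_nonneg _)

theorem continuous_radialKernel (x : EuclideanSpace ℝ (Fin n)) (δ : ℝ) :
    Continuous (radialKernel x δ) :=
  continuous_const.mul (continuous_glueDeriv.comp (by fun_prop))

theorem hasCompactSupport_radialBump (hδ : 0 < δ) : HasCompactSupport (radialBump x δ) :=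
  HasCompactSupport.intro (isCompact_closedBall x δ) fun _ hy =>
    radialBump_of_notMem hδ fun h => hy (ball_subset_closedBall h)

theorem hasCompactSupport_radialKernel (hδ : 0 < δ) : HasCompactSupport (radialKernel x δ) :=
  HasCompactSupport.intro (isCompact_closedBall x δ) fun _ hy =>
    radialKernel_of_notMem hδ fun h => hy (ball_subset_closedBall h)

theorem laplacian_radialBump (hδ : 0 < δ) :
    Laplacian.laplacian (radialBump x δ) y =
      -(2 * n / δ ^ 2 * glueDeriv (1 - ‖y - x‖ ^ 2 / δ ^ 2)) +
        4 * ‖y - x‖ ^ 2 / δ ^ 4 * glueDerivTwo (1 - ‖y - x‖ ^ 2 / δ ^ 2) := by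
  have hin : ∀ t : ℝ, HasDerivAt (fun t => 1 - t / δ ^ 2) (-(1 / δ ^ 2)) t := fun t => by
    simpa using ((hasDerivAt_id t).div_const (δ ^ 2)).const_sub 1
  have h1 : ∀ t : ℝ, HasDerivAt (fun t => expNegInvGlue (1 - t / δ ^ 2))
      (glueDeriv (1 - t / δ ^ 2) * -(1 / δ ^ 2)) t := fun t =>
    (hasDerivAt_expNegInvGlue _).comp t (hin t)
  have h2 : ∀ t : ℝ, HasDerivAt (fun t => glueDeriv (1 - t / δ ^ 2) * -(1 / δ ^ 2))
      (glueDerivTwo (1 - t / δ ^ 2) * -(1 / δ ^ 2) * -(1 / δ ^ 2)) t := fun t =>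
    ((hasDerivAt_glueDeriv _).comp t (hin t)).mul_const _
  unfold radialBump
  rw [laplacian_comp_norm_sub_sq h1 h2 x y]
  field_simp

theorem laplacian_radialBump_of_notMem (hδ : 0 < δ) (hy : y ∉ ball x δ) :
    Laplacian.laplacian (radialBump x δ) y = 0 := by
  rw [laplacian_radialBump hδ, glueDeriv_of_nonpos (one_sub_div_nonpos hδ hy),
    glueDerivTwo_of_nonpos (one_sub_div_nonpos hδ hy)]
  simp

theorem continuous_laplacian_radialBump (hδ : 0 < δ) :
    Continuous (Laplacian.laplacian (radialBump x δ)) := by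
  have : Laplacian.laplacian (radialBump x δ) = fun y => _ :=
    funext fun y => laplacian_radialBump hδ
  rw [this]
  have h1 := continuous_glueDeriv
  have h2 := continuous_glueDerivTwo
  fun_prop

theorem abs_laplacian_radialBump_le {M : ℝ} (hM : ∀ t ≤ 1, |glueDeriv t| ≤ M ∧ |glueDerivTwo t| ≤ M)
    (hδ : 0 < δ) : |Laplacian.laplacian (radialBump x δ) y| ≤ (2 * n + 4) * M / δ ^ 2 := by
  by_cases hy : y ∈ ball x δ
  · rw [laplacian_radialBump hδ]
    have ht : 1 - ‖y - x‖ ^ 2 / δ ^ 2 ≤ 1 := by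
      have : 0 ≤ ‖y - x‖ ^ 2 / δ ^ 2 := by positivity
      linarith
    obtain ⟨h1, h2⟩ := hM _ ht
    have hM0 : 0 ≤ M := (abs_nonneg _).trans h1
    have h3 : ‖y - x‖ ^ 2 ≤ δ ^ 2 := by
      rw [mem_ball_iff_norm] at hy
      gcongr
    refine (abs_add_le _ _).trans ?_
    rw [abs_neg, abs_mul, abs_mul, abs_of_nonneg (by positivity : (0 : ℝ) ≤ 2 * n / δ ^ 2),
      abs_of_nonneg (by positivity : (0 : ℝ) ≤ 4 * ‖y - x‖ ^ 2 / δ ^ 4)]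
    calc _ ≤ 2 * n / δ ^ 2 * M + 4 * δ ^ 2 / δ ^ 4 * M := by gcongr
      _ = _ := by field_simp
  · rw [laplacian_radialBump_of_notMem hδ hy, abs_zero]
    have hM0 : 0 ≤ M := (abs_nonneg _).trans (hM 0 zero_le_one).1
    positivity

/-- With `z = y - x`, the radius derivative of an `Lⁿ`-scaled kernel `k_δ = δ⁻ⁿ k(z/δ)` is `-δ⁻¹
div(z k_δ)`. Here `z k_δ` is a multiple of the gradient of the bump, because the kernel profile is
the derivative of the bump profile. The derivative is therefore a positive multiple of the bump's
Laplacian. -/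
theorem hasDerivAt_radialKernel (hδ : 0 < δ) :
    HasDerivAt (fun d => radialKernel x d y)
      (2⁻¹ * (δ / δ ^ n) * Laplacian.laplacian (radialBump x δ) y) δ := by
  have h1 : HasDerivAt (fun d : ℝ => (d ^ n)⁻¹) (-(n * δ ^ (n - 1)) / (δ ^ n) ^ 2) δ :=
    (hasDerivAt_pow n δ).inv (by positivity)
  have h2 : HasDerivAt (fun d : ℝ => 1 - ‖y - x‖ ^ 2 / d ^ 2) (2 * ‖y - x‖ ^ 2 / δ ^ 3) δ := by
    have := ((hasDerivAt_pow 2 δ).inv (by positivity)).const_mul (‖y - x‖ ^ 2)|>.const_sub 1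
    refine (this.congr_deriv ?_)
    field_simp
    ring
  have h3 := h1.mul ((hasDerivAt_glueDeriv _).comp δ h2)
  refine h3.congr_deriv ?_
  rw [laplacian_radialBump hδ]
  -- The exponent `n - 1` is truncated, so dimension `0` is computed separately.
  rcases n with _ | n
  · simp
    field_simp
    ring
  · simp only [Nat.add_sub_cancel, Function.comp_apply]
    field_simp
    ring

end

/-! ### Monotonicity of radial averages of supersolutions -/

section

variable {n : ℕ} {V u : EuclideanSpace ℝ (Fin n) → ℝ} {x : EuclideanSpace ℝ (Fin n)} {δ : ℝ}

theorem MeasureTheory.LocallyIntegrable.integrable_mul_of_hasCompactSupport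
    {g : EuclideanSpace ℝ (Fin n) → ℝ} (hu : LocallyIntegrable u volume) (hg : Continuous g)
    (hgs : HasCompactSupport g) : Integrable (fun y => u y * g y) :=
  (hu.integrable_smul_left_of_hasCompactSupport hg hgs).congr
    (Eventually.of_forall fun y => by simp [mul_comm])

theorem hasCompactSupport_laplacian_radialBump (hδ : 0 < δ) :
    HasCompactSupport (Laplacian.laplacian (radialBump x δ)) :=
  HasCompactSupport.intro (isCompact_closedBall x δ) fun _ hy =>
    laplacian_radialBump_of_notMem hδ fun h => hy (ball_subset_closedBall h)

theorem hasDerivAt_integral_radialKernel (hu : LocallyIntegrable u volume) (hδ : 0 < δ) :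
    HasDerivAt (fun d => ∫ y, u y * radialKernel x d y)
      (2⁻¹ * (δ / δ ^ n) * ∫ y, u y * Laplacian.laplacian (radialBump x δ) y) δ := by
  obtain ⟨M, hM0, hM⟩ := exists_bound_glueDeriv
  -- A bound uniform in `d ∈ (δ/2, 2δ)`: numerators are taken at `2δ`, denominators at `δ/2`.
  set C : ℝ := 2⁻¹ * (2 * δ / (δ / 2) ^ n) * ((2 * n + 4) * M / (δ / 2) ^ 2) with hC
  have hmem : Ioo (δ / 2) (2 * δ) ∈ 𝓝 δ := Ioo_mem_nhds (by linarith) (by linarith)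
  have key := hasDerivAt_integral_of_dominated_loc_of_deriv_le (μ := volume)
    (F := fun d y => u y * radialKernel x d y)
    (F' := fun d y => u y * (2⁻¹ * (d / d ^ n) * Laplacian.laplacian (radialBump x d) y))
    (bound := (closedBall x (2 * δ)).indicator fun y => |u y| * C) (x₀ := δ) hmem
    ?_ ?_ ?_ ?_ ?_ ?_
  · refine key.2.congr_deriv ?_
    rw [← integral_const_mul]
    exact integral_congr_ae (Eventually.of_forall fun y => by ring)
  · filter_upwards [hmem] with d hd
    exact (hu.integrable_mul_of_hasCompactSupport (continuous_radialKernel x d)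
      (hasCompactSupport_radialKernel (by linarith [hd.1]))).aestronglyMeasurable
  · exact hu.integrable_mul_of_hasCompactSupport (continuous_radialKernel x δ)
      (hasCompactSupport_radialKernel hδ)
  · exact hu.aestronglyMeasurable.mul
      (continuous_const.mul (continuous_laplacian_radialBump hδ)).aestronglyMeasurable
  · refine Eventually.of_forall fun y d hd => ?_
    have hd0 : 0 < d := by linarith [hd.1]
    by_cases hy : y ∈ closedBall x (2 * δ)
    · rw [indicator_of_mem hy, norm_mul, Real.norm_eq_abs, norm_mul, Real.norm_eq_abs,
        Real.norm_eq_abs, abs_of_nonneg (by positivity : 0 ≤ 2⁻¹ * (d / d ^ n))]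
      have h1 := abs_laplacian_radialBump_le (x := x) (y := y) hM hd0
      have h2 : δ / 2 ≤ d := hd.1.le
      have h3 : d ≤ 2 * δ := hd.2.le
      calc _ ≤ |u y| * (2⁻¹ * (d / d ^ n) * ((2 * n + 4) * M / d ^ 2)) := by gcongr
        _ ≤ |u y| * C := by rw [hC]; gcongr
    · rw [indicator_of_notMem hy, laplacian_radialBump_of_notMem hd0]
      · simp
      · exact fun h => hy (ball_subset_closedBall (ball_subset_ball hd.2.le h))
  · rw [integrable_indicator_iff measurableSet_closedBall]
    exact ((hu.integrableOn_isCompact (isCompact_closedBall x (2 * δ))).abs).mul_const C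
  · refine Eventually.of_forall fun y d hd => ?_
    exact (hasDerivAt_radialKernel (by linarith [hd.1])).const_mul (u y)

/-- Radial averages of a supersolution decrease with the radius. -/
theorem IsWeakSolution.antitoneOn_integral_radialKernel (hu : IsWeakSolution V u) {D : ℝ}
    (hpos : ∀ᵐ y, y ∈ ball x D → 0 ≤ V y * u y) :
    AntitoneOn (fun d => ∫ y, u y * radialKernel x d y) (Ioo 0 D) := by
  have hd : ∀ d ∈ Ioo 0 D, HasDerivAt (fun d => ∫ y, u y * radialKernel x d y)
      (2⁻¹ * (d / d ^ n) * ∫ y, u y * Laplacian.laplacian (radialBump x d) y) d :=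
    fun d hd => hasDerivAt_integral_radialKernel hu.locallyIntegrable hd.1
  refine antitoneOn_of_deriv_nonpos (convex_Ioo 0 D)
    (fun d hd' => (hd d hd').continuousAt.continuousWithinAt) ?_ ?_
  · rw [interior_Ioo]
    exact fun d hd' => (hd d hd').differentiableAt.differentiableWithinAt
  · rw [interior_Ioo]
    intro d hd'
    rw [(hd d hd').deriv]
    have h0 := hd'.1
    refine mul_nonpos_of_nonneg_of_nonpos (by positivity) ?_
    -- The equation turns the Laplacian term into the integral of `V u` against a nonnegative bump.
    rw [← neg_nonneg, hu.weak_eq _ (contDiff_radialBump x d) (hasCompactSupport_radialBump h0)]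
    refine integral_nonneg_of_ae ?_
    filter_upwards [hpos] with y hy
    by_cases hyb : y ∈ ball x d
    · exact mul_nonneg (hy (ball_subset_ball hd'.2.le hyb)) radialBump_nonneg
    · simp [radialBump_of_notMem h0 hyb]

/-- The mass of the averaging kernels. -/
noncomputable def kernelMass (n : ℕ) : ℝ :=
  ∫ y : EuclideanSpace ℝ (Fin n), radialKernel 0 1 y

theorem integral_radialKernel (hδ : 0 < δ) : ∫ y, radialKernel x δ y = kernelMass n := by
  have h1 : ∫ y, radialKernel x δ y = ∫ y, radialKernel (0 : EuclideanSpace ℝ (Fin n)) δ y := by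
    rw [← integral_add_right_eq_self _ x]
    simp [radialKernel]
  have h2 := Measure.integral_comp_inv_smul (volume : Measure (EuclideanSpace ℝ (Fin n)))
    (radialKernel 0 1) δ
  rw [h1, kernelMass]
  rw [finrank_euclideanSpace_fin, abs_of_nonneg (by positivity), smul_eq_mul] at h2
  have h3 : ∀ y : EuclideanSpace ℝ (Fin n),
      radialKernel 0 δ y = (δ ^ n)⁻¹ * radialKernel 0 1 (δ⁻¹ • y) := fun y => by
    simp [radialKernel, norm_smul, abs_of_pos hδ, div_eq_inv_mul, mul_pow]
  simp_rw [h3]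
  rw [integral_const_mul, h2]
  field_simp

theorem volume_real_unit_ball_pos (n : ℕ) :
    0 < volume.real (ball (0 : EuclideanSpace ℝ (Fin n)) 1) :=
  ENNReal.toReal_pos (measure_ball_pos _ _ one_pos).ne' measure_ball_lt_top.ne

theorem volume_real_closedBall (x : EuclideanSpace ℝ (Fin n)) (hδ : 0 ≤ δ) :
    volume.real (closedBall x δ) =
      δ ^ n * volume.real (ball (0 : EuclideanSpace ℝ (Fin n)) 1) := by
  rw [Measure.real, Measure.addHaar_closedBall _ _ hδ, finrank_euclideanSpace_fin,
    ENNReal.toReal_mul, ENNReal.toReal_ofReal (by positivity)]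
  rfl

/-- At almost every point the radial averages converge to the value. -/
theorem ae_tendsto_integral_radialKernel (hu : LocallyIntegrable u volume) :
    ∀ᵐ x, Tendsto (fun d => ∫ y, u y * radialKernel x d y) (𝓝[>] 0) (𝓝 (kernelMass n * u x)) := by
  obtain ⟨M, hM0, hM⟩ := exists_bound_glueDeriv
  -- At a Lebesgue point the error is at most `M b` times the average of `|u - u x|` over the ball
  -- of radius `d`: the kernel is at most `M / dⁿ` and the ball has volume `b dⁿ`.
  filter_upwards [IsUnifLocDoublingMeasure.ae_tendsto_average_norm_sub volume hu 1] with x hx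
  have hav := hx (fun _ : ℝ => x) (fun d => d) (l := 𝓝[>] (0 : ℝ)) tendsto_id (by
    filter_upwards [self_mem_nhdsWithin] with d hd
    exact mem_closedBall_self (by simpa using (mem_Ioi.1 hd).le))
  set b : ℝ := volume.real (ball (0 : EuclideanSpace ℝ (Fin n)) 1) with hb
  have hb0 : 0 < b := volume_real_unit_ball_pos n
  rw [tendsto_iff_norm_sub_tendsto_zero]
  refine squeeze_zero' (Eventually.of_forall fun _ => norm_nonneg _) ?_
    (by simpa using hav.const_mul (M * b))
  filter_upwards [self_mem_nhdsWithin] with d hd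
  have hd0 : 0 < d := hd
  have hk := (continuous_radialKernel x d).integrable_of_hasCompactSupport (μ := volume)
    (hasCompactSupport_radialKernel hd0)
  have hint := hu.integrable_mul_of_hasCompactSupport (continuous_radialKernel x d)
    (hasCompactSupport_radialKernel hd0)
  have h1 : (∫ y, u y * radialKernel x d y) - kernelMass n * u x =
      ∫ y, (u y - u x) * radialKernel x d y := by
    rw [← integral_radialKernel (x := x) hd0, mul_comm, ← integral_const_mul,
      ← integral_sub hint (hk.const_mul _)]
    exact integral_congr_ae (Eventually.of_forall fun y => by ring)
  have h2 : ∀ y, ‖(u y - u x) * radialKernel x d y‖ ≤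
      (closedBall x d).indicator (fun y => ‖u y - u x‖ * ((d ^ n)⁻¹ * M)) y := fun y => by
    by_cases hy : y ∈ closedBall x d
    · rw [indicator_of_mem hy, norm_mul]
      gcongr
      rw [radialKernel, norm_mul, Real.norm_of_nonneg (by positivity)]
      gcongr
      refine (hM _ ?_).1
      have : 0 ≤ ‖y - x‖ ^ 2 / d ^ 2 := by positivity
      linarith
    · rw [indicator_of_notMem hy, radialKernel_of_notMem hd0 fun h => hy (ball_subset_closedBall h)]
      simp
  have h3 : IntegrableOn (fun y => ‖u y - u x‖) (closedBall x d) :=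
    ((hu.integrableOn_isCompact (isCompact_closedBall x d)).sub
      (integrableOn_const measure_closedBall_lt_top.ne)).norm
  rw [h1]
  refine (norm_integral_le_of_norm_le ((integrable_indicator_iff measurableSet_closedBall).2
    (h3.mul_const _)) (Eventually.of_forall h2)).trans ?_
  rw [integral_indicator measurableSet_closedBall, integral_mul_const, setAverage_eq, smul_eq_mul]
  have h4 : volume.real (closedBall x d) = d ^ n * b := volume_real_closedBall x hd0.le
  rw [h4]
  refine le_of_eq ?_
  field_simp
  rfl

theorem kernelMass_pos (n : ℕ) : 0 < kernelMass n := by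
  refine (continuous_radialKernel 0 1).integral_pos_of_hasCompactSupport_nonneg_nonzero
    (hasCompactSupport_radialKernel one_pos) (fun y => radialKernel_nonneg one_pos) (x := 0) ?_
  simpa [radialKernel] using (glueDeriv_pos one_pos).ne'

/-- The weak Harnack inequality for weak supersolutions. -/
theorem exists_weak_harnack (n : ℕ) : ∃ c : ℝ, 0 < c ∧
    ∀ (V u : EuclideanSpace ℝ (Fin n) → ℝ), IsWeakSolution V u →
    ∀ (x₀ : EuclideanSpace ℝ (Fin n)) (s : ℝ), 0 < s →
    (∀ᵐ y, y ∈ ball x₀ (6 * s) → 0 ≤ u y ∧ 0 ≤ V y * u y) →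
    ∀ᵐ x, x ∈ ball x₀ s → c / s ^ n * ∫ y in closedBall x₀ (2 * s), u y ≤ u x := by
  obtain ⟨m, hm0, hm⟩ := exists_pos_le_glueDeriv
  have hc0 := kernelMass_pos n
  refine ⟨m / (4 ^ n * kernelMass n), by positivity, fun V u hu x₀ s hs hpos => ?_⟩
  filter_upwards [ae_tendsto_integral_radialKernel hu.locallyIntegrable] with x hx hxs
  rw [mem_ball] at hxs
  have hsub : ball x (5 * s) ⊆ ball x₀ (6 * s) := ball_subset_ball' (by linarith)
  have hanti := hu.antitoneOn_integral_radialKernel (x := x) (D := 5 * s) (by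
    filter_upwards [hpos] with y hy hyb using (hy (hsub hyb)).2)
  -- Radius `4s` is less than `5s`, where monotonicity holds, and exceeds `3s`, so the kernel is
  -- bounded below on `B(x₀, 2s) ⊆ B(x, 3s)`.
  have h4 : (4 * s) ∈ Ioo 0 (5 * s) := ⟨by linarith, by linarith⟩
  have hle : ∫ y, u y * radialKernel x (4 * s) y ≤ kernelMass n * u x := by
    refine ge_of_tendsto hx ?_
    filter_upwards [Ioo_mem_nhdsGT h4.1] with d hd
    exact hanti ⟨hd.1, hd.2.trans h4.2⟩ h4 hd.2.le
  have hlow : ∫ y in closedBall x₀ (2 * s), u y * (((4 * s) ^ n)⁻¹ * m) ≤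
      ∫ y, u y * radialKernel x (4 * s) y := by
    rw [← integral_indicator measurableSet_closedBall]
    refine integral_mono_ae ((integrable_indicator_iff measurableSet_closedBall).2
      ((hu.locallyIntegrable.integrableOn_isCompact (isCompact_closedBall _ _)).mul_const _))
      (hu.locallyIntegrable.integrable_mul_of_hasCompactSupport (continuous_radialKernel _ _)
        (hasCompactSupport_radialKernel h4.1)) ?_
    filter_upwards [hpos] with y hy
    by_cases hyb : y ∈ closedBall x₀ (2 * s)
    · rw [indicator_of_mem hyb]
      rw [mem_closedBall] at hyb
      have hu0 : 0 ≤ u y := (hy (mem_ball.2 (by linarith))).1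
      refine mul_le_mul_of_nonneg_left ?_ hu0
      refine mul_le_mul_of_nonneg_left (hm _ ⟨?_, ?_⟩) (by positivity)
      · have h1 : ‖y - x‖ ≤ 3 * s := by
          rw [← dist_eq_norm]
          have := dist_triangle y x₀ x
          rw [dist_comm x₀ x] at this
          linarith
        have h2 : ‖y - x‖ ^ 2 / (4 * s) ^ 2 ≤ (3 * s) ^ 2 / (4 * s) ^ 2 := by gcongr
        have h3 : (3 * s) ^ 2 / (4 * s) ^ 2 = 9 / 16 := by field_simp; norm_num
        linarith
      · have : 0 ≤ ‖y - x‖ ^ 2 / (4 * s) ^ 2 := by positivity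
        linarith
    · rw [indicator_of_notMem hyb]
      by_cases hyx : y ∈ ball x (4 * s)
      · exact mul_nonneg (hy (hsub (ball_subset_ball (by linarith) hyx))).1
          (radialKernel_nonneg h4.1)
      · simp [radialKernel_of_notMem h4.1 hyx]
  rw [integral_mul_const] at hlow
  rw [div_div, div_mul_eq_mul_div, div_le_iff₀ (by positivity)]
  have h5 := hlow.trans hle
  have h6 : (0 : ℝ) < (4 * s) ^ n := by positivity
  rw [← mul_assoc, mul_comm _ m, ← div_eq_mul_inv, mul_div_assoc', div_le_iff₀ h6] at h5
  rw [mul_pow] at h5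
  linarith
end

/-! ### Vanishing near infinity -/

section

variable {n : ℕ} {V u : EuclideanSpace ℝ (Fin n) → ℝ}

theorem IsLinftyLoc.locallyIntegrable (hV : IsLinftyLoc V) : LocallyIntegrable V volume := by
  refine (locallyIntegrable_iff).2 fun K hK => ?_
  have : IsFiniteMeasure (volume.restrict K) := ⟨by simpa using hK.measure_lt_top⟩
  exact (hV.2 K hK).integrable le_top

/-- A nonnegative potential has small mass on balls where a nontrivial nonnegative solution
exists. -/
theorem exists_integral_potential_le (n : ℕ) : ∃ C : ℝ, 0 < C ∧
    ∀ (V u : EuclideanSpace ℝ (Fin n) → ℝ), LocallyIntegrable V volume → IsWeakSolution V u →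
    ∀ (x₀ : EuclideanSpace ℝ (Fin n)) (s : ℝ), 0 < s →
    (∀ᵐ y, y ∈ ball x₀ (6 * s) → 0 ≤ u y ∧ 0 ≤ V y) →
    0 < ∫ y in closedBall x₀ (2 * s), u y →
    ∫ y in closedBall x₀ (s / 2), V y ≤ C * s ^ n / s ^ 2 := by
  obtain ⟨c, hc, H⟩ := exists_weak_harnack n
  obtain ⟨M, hM0, hM⟩ := exists_bound_glueDeriv
  set e : ℝ := expNegInvGlue (3 / 4) with he
  have he0 : 0 < e := expNegInvGlue.pos_of_pos (by norm_num)
  -- The constant compares the Laplacian bound for the bump of radius `2s` with its lower bound `e`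
  -- on the small ball times the Harnack constant `c`.
  refine ⟨(2 * n + 4) * M / (4 * e * c), by positivity, fun V u hV hu x₀ s hs hpos hI => ?_⟩
  have hs2 : 0 < 2 * s := by linarith
  set I := ∫ y in closedBall x₀ (2 * s), u y with hIdef
  have hVu := hu.locallyIntegrable_mul
  have hu' := hu.locallyIntegrable
  have hpos' : ∀ᵐ y, y ∈ ball x₀ (6 * s) → 0 ≤ u y ∧ 0 ≤ V y * u y := by
    filter_upwards [hpos] with y hy hyb
    exact ⟨(hy hyb).1, mul_nonneg (hy hyb).2 (hy hyb).1⟩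
  have h1 : c / s ^ n * I * ∫ y in closedBall x₀ (s / 2), V y ≤
      ∫ y in closedBall x₀ (s / 2), V y * u y := by
    rw [← integral_const_mul]
    refine setIntegral_mono_on_ae
      ((hV.integrableOn_isCompact (isCompact_closedBall _ _)).const_mul _)
      (hVu.integrableOn_isCompact (isCompact_closedBall _ _)) measurableSet_closedBall ?_
    filter_upwards [hpos, H V u hu x₀ s hs hpos'] with y hy hyH hyb
    rw [mem_closedBall] at hyb
    have h2 := hyH (mem_ball.2 (by linarith))
    rw [mul_comm]
    exact mul_le_mul_of_nonneg_left h2 (hy (mem_ball.2 (by linarith))).2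
  have h2 : ∫ y in closedBall x₀ (s / 2), e * (V y * u y) ≤
      ∫ y, V y * u y * radialBump x₀ (2 * s) y := by
    rw [← integral_indicator measurableSet_closedBall]
    refine integral_mono_ae ((integrable_indicator_iff measurableSet_closedBall).2
      ((hVu.integrableOn_isCompact (isCompact_closedBall _ _)).const_mul _))
      (hVu.integrable_mul_of_hasCompactSupport (contDiff_radialBump _ _).continuous
        (hasCompactSupport_radialBump hs2)) ?_
    filter_upwards [hpos'] with y hy
    by_cases hyb : y ∈ closedBall x₀ (s / 2)
    · rw [indicator_of_mem hyb, mul_comm]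
      rw [mem_closedBall, dist_eq_norm] at hyb
      refine mul_le_mul_of_nonneg_left (expNegInvGlue.monotone ?_)
        (hy (mem_ball_iff_norm.2 (by linarith))).2
      have h3 : ‖y - x₀‖ ^ 2 / (2 * s) ^ 2 ≤ s ^ 2 / (2 * s) ^ 2 := by
        gcongr
        linarith
      have h4 : s ^ 2 / (2 * s) ^ 2 = 1 / 4 := by field_simp; norm_num
      linarith
    · rw [indicator_of_notMem hyb]
      by_cases hyx : y ∈ ball x₀ (2 * s)
      · exact mul_nonneg (hy (ball_subset_ball (by linarith) hyx)).2 radialBump_nonneg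
      · simp [radialBump_of_notMem hs2 hyx]
  rw [← hu.weak_eq _ (contDiff_radialBump _ _) (hasCompactSupport_radialBump hs2),
    ← integral_neg, integral_const_mul] at h2
  have h3 : ∫ y, -(u y * Laplacian.laplacian (radialBump x₀ (2 * s)) y) ≤
      (2 * n + 4) * M / (2 * s) ^ 2 * I := by
    rw [hIdef, ← integral_const_mul, ← integral_indicator measurableSet_closedBall]
    refine integral_mono_ae (hu'.integrable_mul_of_hasCompactSupport
        (continuous_laplacian_radialBump hs2) (hasCompactSupport_laplacian_radialBump hs2)).neg
      ((integrable_indicator_iff measurableSet_closedBall).2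
      ((hu'.integrableOn_isCompact (isCompact_closedBall _ _)).const_mul _)) ?_
    filter_upwards [hpos] with y hy
    by_cases hyb : y ∈ closedBall x₀ (2 * s)
    · rw [indicator_of_mem hyb]
      rw [mem_closedBall] at hyb
      rw [← mul_neg, mul_comm]
      refine mul_le_mul_of_nonneg_right ?_ (hy (mem_ball.2 (by linarith))).1
      exact (neg_le_abs _).trans (abs_laplacian_radialBump_le hM hs2)
    · rw [indicator_of_notMem hyb,
        laplacian_radialBump_of_notMem hs2 fun h => hyb (ball_subset_closedBall h)]
      simp
  set J := ∫ y in closedBall x₀ (s / 2), V y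
  have h4 : e * (c / s ^ n * I * J) ≤ (2 * n + 4) * M / (2 * s) ^ 2 * I :=
    (mul_le_mul_of_nonneg_left h1 he0.le).trans (h2.trans h3)
  -- Positivity of `I` is used here: it occurs linearly on both sides and cancels.
  have h5 : e * (c / s ^ n) * J ≤ (2 * n + 4) * M / (2 * s) ^ 2 := by
    refine le_of_mul_le_mul_right ?_ hI
    linarith
  have h6 : J ≤ (2 * n + 4) * M / (2 * s) ^ 2 / (e * (c / s ^ n)) := by
    rw [le_div_iff₀ (by positivity)]
    linarith
  refine h6.trans (le_of_eq ?_)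
  field_simp
  norm_num

/-- Real form of the integrability of `1 / (|x|^(n+2) V)`. -/
theorem integrableOn_inv_potential {r : ℝ} (hr : 0 < r) (hV : AEStronglyMeasurable V volume)
    (hV_inv : (∫⁻ x in {x : EuclideanSpace ℝ (Fin n) | r < ‖x‖},
      1 / ENNReal.ofReal (‖x‖ ^ (n + 2) * V x)) < ⊤) :
    (∀ᵐ x, r < ‖x‖ → 0 < V x) ∧
      IntegrableOn (fun x => (‖x‖ ^ (n + 2) * V x)⁻¹) {x | r < ‖x‖} := by
  have hS : MeasurableSet {x : EuclideanSpace ℝ (Fin n) | r < ‖x‖} :=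
    measurableSet_lt measurable_const measurable_norm
  have hm : AEMeasurable (fun x => ‖x‖ ^ (n + 2) * V x) volume :=
    (measurable_norm.pow_const _).aemeasurable.mul hV.aemeasurable
  have hm' : AEMeasurable (fun x => 1 / ENNReal.ofReal (‖x‖ ^ (n + 2) * V x))
      (volume.restrict {x : EuclideanSpace ℝ (Fin n) | r < ‖x‖}) :=
    (hm.ennreal_ofReal.const_div 1).restrict
  have h1 := ae_lt_top' hm' hV_inv.ne
  rw [ae_restrict_iff' hS] at h1
  have hpos : ∀ᵐ x, r < ‖x‖ → 0 < V x := by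
    filter_upwards [h1] with x hx hxr
    have h2 := hx hxr
    -- Where `V ≤ 0` the integrand is `1/0 = ∞`, which is excluded almost everywhere.
    by_contra hneg
    have h3 : ‖x‖ ^ (n + 2) * V x ≤ 0 :=
      mul_nonpos_of_nonneg_of_nonpos (by positivity) (not_lt.1 hneg)
    simp [ENNReal.ofReal_of_nonpos h3] at h2
  refine ⟨hpos, (hm.inv.restrict).aestronglyMeasurable, ?_⟩
  rw [hasFiniteIntegral_iff_ofReal]
  · refine lt_of_le_of_lt (lintegral_mono_ae ?_) hV_inv
    refine (ae_restrict_iff' hS).2 ?_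
    filter_upwards [hpos] with x hx hxr
    have := hx hxr
    have h0 : 0 < ‖x‖ := hr.trans hxr
    rw [one_div, ENNReal.ofReal_inv_of_pos (by positivity)]
  · refine (ae_restrict_iff' hS).2 ?_
    filter_upwards [hpos] with x hx hxr
    have := hx hxr
    simp only [Pi.zero_apply]
    positivity

theorem tendsto_setIntegral_norm_gt {W : EuclideanSpace ℝ (Fin n) → ℝ} {r : ℝ}
    (hW : IntegrableOn W {x | r < ‖x‖}) :
    Tendsto (fun ρ : ℝ => ∫ x in {x | ρ < ‖x‖}, W x) atTop (𝓝 0) := by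
  have h := tendsto_setIntegral_of_antitone (μ := volume) (f := W)
    (s := fun ρ : ℝ => {x : EuclideanSpace ℝ (Fin n) | ρ < ‖x‖})
    (fun ρ => measurableSet_lt measurable_const measurable_norm)
    (fun a b hab x hx => lt_of_le_of_lt hab hx) ⟨r, hW⟩
  have h0 : (⋂ ρ : ℝ, {x : EuclideanSpace ℝ (Fin n) | ρ < ‖x‖}) = ∅ := by
    ext x
    simp only [mem_iInter, mem_ofPred_eq, mem_empty_iff_false, iff_false, not_forall]
    exact ⟨‖x‖, lt_irrefl _⟩
  simpa [h0] using h

/-- A solution that is nonnegative near infinity vanishes near infinity. -/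
theorem IsWeakSolution.exists_ae_eq_zero_of_nonneg {r : ℝ} (hr : 0 < r) (hV : IsLinftyLoc V)
    (hV_inv : (∫⁻ x in {x : EuclideanSpace ℝ (Fin n) | r < ‖x‖},
      1 / ENNReal.ofReal (‖x‖ ^ (n + 2) * V x)) < ⊤)
    (hu : IsWeakSolution V u) (hpos : NonnegNearInfinity u) :
    ∃ R : ℝ, 0 < R ∧ ∀ᵐ x, R < ‖x‖ → u x = 0 := by
  obtain ⟨R, hR⟩ := hpos
  obtain ⟨hVpos, hW⟩ := integrableOn_inv_potential hr hV.1 hV_inv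
  obtain ⟨C, hC, HC⟩ := exists_integral_potential_le n
  have hVl := hV.locallyIntegrable
  set W : EuclideanSpace ℝ (Fin n) → ℝ := fun x => (‖x‖ ^ (n + 2) * V x)⁻¹ with hWdef
  -- A ball of radius `s/2` has volume `b sⁿ`.
  set b : ℝ := volume.real (ball (0 : EuclideanSpace ℝ (Fin n)) 1) / 2 ^ n with hb
  have hb0 : 0 < b := div_pos (volume_real_unit_ball_pos n) (by positivity)
  -- Chosen so that the `W` term below is at most `b sⁿ / 4`; with the `V` term at most `b sⁿ / 2`,
  -- the sum is less than the volume. The factor `11` comes from `|y| ≤ 11s` on `B(x₀, s/2)`.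
  set ε : ℝ := b ^ 2 / (2 * C * 11 ^ (n + 2)) with hε
  have hε0 : 0 < ε := by positivity
  obtain ⟨ρ₀, hρ₀⟩ := eventually_atTop.1 ((tendsto_setIntegral_norm_gt hW).eventually_lt_const hε0)
  set s₀ := max 1 (max r (max R ρ₀)) with hs₀
  have key : ∀ x₀ : EuclideanSpace ℝ (Fin n), 10 * s₀ < ‖x₀‖ →
      ∀ᵐ y, y ∈ closedBall x₀ (2 * (‖x₀‖ / 10)) → u y = 0 := by
    intro x₀ hx₀
    -- The ball `B(x₀, 6s)` then stays in `|y| ≥ 4s`, where both `u` and `V` are nonnegative.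
    set s := ‖x₀‖ / 10 with hs
    have hxs : ‖x₀‖ = 10 * s := by rw [hs]; ring
    have hss : s₀ < s := by linarith
    have h1s : 1 < s := (le_max_left _ _).trans_lt hss
    have hrs : r < s := ((le_max_left _ _).trans (le_max_right _ _)).trans_lt hss
    have hRs : R < s :=
      ((le_max_left _ _).trans ((le_max_right _ _).trans (le_max_right _ _))).trans_lt hss
    have hρs : ρ₀ < s :=
      ((le_max_right _ _).trans ((le_max_right _ _).trans (le_max_right _ _))).trans_lt hss
    have hs0 : 0 < s := by linarith
    have hnorm : ∀ t : ℝ, ∀ y ∈ closedBall x₀ t, 10 * s - t ≤ ‖y‖ ∧ ‖y‖ ≤ 10 * s + t := by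
      intro t y hy
      rw [mem_closedBall, dist_eq_norm] at hy
      have h1 := norm_sub_norm_le x₀ y
      have h2 := norm_sub_norm_le y x₀
      rw [norm_sub_rev] at h1
      constructor <;> linarith
    have hext : ∀ᵐ y, y ∈ ball x₀ (6 * s) → 0 ≤ u y ∧ 0 ≤ V y := by
      filter_upwards [hR, hVpos] with y h1 h2 hy
      have := (hnorm _ y (ball_subset_closedBall hy)).1
      exact ⟨h1 (by linarith), (h2 (by linarith)).le⟩
    have hI : ¬ 0 < ∫ y in closedBall x₀ (2 * s), u y := by
      intro hI
      have hJ := HC V u hVl hu x₀ s hs0 hext hI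
      set B := closedBall x₀ (s / 2) with hB
      have hBr : B ⊆ {x | s < ‖x‖} := fun y hy => by
        have := (hnorm _ y hy).1
        simp only [mem_ofPred_eq]
        linarith
      have hWs : IntegrableOn W {x | s < ‖x‖} := hW.mono_set fun y hy => hrs.trans hy
      have hWB : IntegrableOn W B := hWs.mono_set hBr
      have hWle : ∫ y in B, W y ≤ ε := by
        refine (setIntegral_mono_set hWs ?_ hBr.eventuallyLE).trans (hρ₀ s hρs.le).le
        rw [EventuallyLE, ae_restrict_iff' (measurableSet_lt measurable_const measurable_norm)]
        filter_upwards [hVpos] with y hy hys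
        have := hy (hrs.trans hys)
        simp only [hWdef, Pi.zero_apply]
        positivity
      set k : ℝ := b / C with hk
      have hk0 : 0 < k := by positivity
      have hVB : IntegrableOn V B := hVl.integrableOn_isCompact (isCompact_closedBall _ _)
      have hone : ∫ _ in B, (1 : ℝ) ≤
          ∫ y in B, (2⁻¹ * (k * s ^ 2) * V y + 2⁻¹ * ((11 * s) ^ (n + 2) / (k * s ^ 2)) * W y) := by
        refine setIntegral_mono_on_ae (integrableOn_const measure_closedBall_lt_top.ne)
          ((hVB.const_mul _).add (hWB.const_mul _)) measurableSet_closedBall ?_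
        filter_upwards [hVpos] with y hy hyB
        have hV0 : 0 < V y := hy (hrs.trans (hBr hyB))
        have hy0 : 0 < ‖y‖ := hs0.trans (hBr hyB)
        have hy11 : ‖y‖ ≤ 11 * s := by linarith [(hnorm _ y hyB).2]
        have h1 : (V y)⁻¹ ≤ (11 * s) ^ (n + 2) * W y := by
          have : (V y)⁻¹ = ‖y‖ ^ (n + 2) * W y := by
            simp only [hWdef]
            field_simp
          rw [this]
          have hW0 : 0 ≤ W y := by simp only [hWdef]; positivity
          gcongr
        set L := k * s ^ 2 with hL
        have hL0 : 0 < L := by positivity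
        -- Cauchy-Schwarz in its pointwise form `1 ≤ (t + 1/t) / 2` with `t = L V`; the weight `L =
        -- (b/C) s²` balances the bound on `∫ V`.
        have h2 : 1 ≤ 2⁻¹ * L * V y + 2⁻¹ * (L⁻¹ * (V y)⁻¹) := by
          have h3 : 0 < L * V y := by positivity
          rw [← mul_inv, mul_assoc]
          have h4 : 0 ≤ (L * V y - 1) ^ 2 / (L * V y) := by positivity
          have h5 : (L * V y - 1) ^ 2 / (L * V y) = L * V y + (L * V y)⁻¹ - 2 := by
            field_simp
            ring
          linarith
        have h6 : L⁻¹ * (V y)⁻¹ ≤ (11 * s) ^ (n + 2) / L * W y := by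
          calc L⁻¹ * (V y)⁻¹ ≤ L⁻¹ * ((11 * s) ^ (n + 2) * W y) := by gcongr
            _ = _ := by ring
        linarith
      rw [integral_add (hVB.const_mul _) (hWB.const_mul _), integral_const_mul,
        integral_const_mul] at hone
      have hvol : ∫ _ in B, (1 : ℝ) = b * s ^ n := by
        rw [setIntegral_const, hB, volume_real_closedBall x₀ (by positivity), hb, div_pow]
        simp
        ring
      rw [hvol] at hone
      have h7 : 2⁻¹ * (k * s ^ 2) * ∫ y in B, V y ≤ 2⁻¹ * b * s ^ n := by
        calc _ ≤ 2⁻¹ * (k * s ^ 2) * (C * s ^ n / s ^ 2) := by gcongr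
          _ = _ := by rw [hk]; field_simp
      have h8 : 2⁻¹ * ((11 * s) ^ (n + 2) / (k * s ^ 2)) * ∫ y in B, W y ≤ 4⁻¹ * b * s ^ n := by
        calc _ ≤ 2⁻¹ * ((11 * s) ^ (n + 2) / (k * s ^ 2)) * ε := by gcongr
          _ = _ := by rw [hk, hε]; field_simp; rw [mul_pow, pow_add s]; ring
      have h9 : 0 < b * s ^ n := by positivity
      linarith
    have hnn : ∀ᵐ y ∂(volume.restrict (closedBall x₀ (2 * s))), 0 ≤ u y := by
      rw [ae_restrict_iff' measurableSet_closedBall]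
      filter_upwards [hext] with y hy hyb
      rw [mem_closedBall] at hyb
      exact (hy (mem_ball.2 (by linarith))).1
    have hz : ∫ y in closedBall x₀ (2 * s), u y = 0 :=
      le_antisymm (not_lt.1 hI) (integral_nonneg_of_ae hnn)
    rw [integral_eq_zero_iff_of_nonneg_ae hnn
      (hu.locallyIntegrable.integrableOn_isCompact (isCompact_closedBall _ _)), EventuallyEq,
      ae_restrict_iff' measurableSet_closedBall] at hz
    exact hz
  refine ⟨10 * s₀, by positivity, ?_⟩
  -- The local statement becomes global because a locally null set is null.
  have hnull : volume {x : EuclideanSpace ℝ (Fin n) | 10 * s₀ < ‖x‖ ∧ u x ≠ 0} = 0 := by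
    refine measure_null_of_locally_null _ fun x₀ hx₀ => ?_
    have h0 : 0 < ‖x₀‖ := lt_trans (by positivity) hx₀.1
    refine ⟨_, inter_mem_nhdsWithin _ (closedBall_mem_nhds x₀
      (by positivity : 0 < 2 * (‖x₀‖ / 10))), ?_⟩
    refine measure_mono_null ?_ (ae_iff.1 (key x₀ hx₀.1))
    intro y hy
    simp only [mem_ofPred_eq, Classical.not_imp]
    exact ⟨hy.2, hy.1.2⟩
  rw [ae_iff]
  simpa only [Classical.not_imp] using hnull

end

/-! ### Plancherel's theorem for integrable square-integrable functions -/

open FourierTransform in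
-- The `L²` transform and the Fourier integral define the same distribution: against a test
-- function, both move the transform onto that function.
theorem ae_eq_fourier_toLp {n : ℕ} {f : EuclideanSpace ℝ (Fin n) → ℂ} (h1 : Integrable f)
    (h2 : MemLp f 2) : (𝓕 (h2.toLp f) : Lp ℂ 2 volume) =ᵐ[volume] 𝓕 f := by
  have hcont : Continuous (𝓕 f) :=
    VectorFourier.fourierIntegral_continuous Real.continuous_fourierChar continuous_inner h1
  refine ae_eq_of_integral_contDiff_smul_eq
    ((Lp.memLp _).locallyIntegrable one_le_two) hcont.locallyIntegrable fun g hg hgs => ?_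
  have hG1 : ContDiff ℝ ∞ fun x => (g x : ℂ) := Complex.ofRealCLM.contDiff.comp hg
  have hG2 : HasCompactSupport fun x => (g x : ℂ) := hgs.comp_left Complex.ofReal_zero
  set G : SchwartzMap (EuclideanSpace ℝ (Fin n)) ℂ := hG2.toSchwartzMap hG1 with hG
  have e1 := Lp.toTemperedDistribution_apply (𝓕 (h2.toLp f)) G
  rw [← Lp.fourier_toTemperedDistribution_eq, TemperedDistribution.fourier_apply,
    Lp.toTemperedDistribution_apply] at e1
  have e2 : ∫ x, g x • (𝓕 (h2.toLp f) : Lp ℂ 2 volume) x =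
      ∫ x, G x • (𝓕 (h2.toLp f) : Lp ℂ 2 volume) x :=
    integral_congr_ae (Eventually.of_forall fun x => by simp [hG])
  have e3 : ∫ x, g x • 𝓕 f x = ∫ x, G x • 𝓕 f x :=
    integral_congr_ae (Eventually.of_forall fun x => by simp [hG])
  rw [e2, e3, ← e1]
  have e4 : ∫ x, (𝓕 G) x • (h2.toLp f) x = ∫ x, 𝓕 (G : EuclideanSpace ℝ (Fin n) → ℂ) x • f x := by
    refine integral_congr_ae ?_
    filter_upwards [h2.coeFn_toLp] with x hx
    rw [hx, SchwartzMap.fourier_coe]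
  rw [e4]
  have e5 := VectorFourier.integral_fourierIntegral_smul_eq_flip (μ := volume) (ν := volume)
    (L := innerₗ (EuclideanSpace ℝ (Fin n))) Real.continuous_fourierChar continuous_inner
    G.integrable h1
  simpa [flip_innerₗ] using! e5

open FourierTransform in
theorem eLpNorm_fourier_eq {n : ℕ} {f : EuclideanSpace ℝ (Fin n) → ℂ} (h1 : Integrable f)
    (h2 : MemLp f 2) : eLpNorm (𝓕 f) 2 volume = eLpNorm f 2 volume := by
  rw [← eLpNorm_congr_ae (ae_eq_fourier_toLp h1 h2), ← eLpNorm_congr_ae h2.coeFn_toLp]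
  have h := Lp.norm_fourier_eq (h2.toLp f)
  rw [Lp.norm_def, Lp.norm_def] at h
  exact (ENNReal.toReal_eq_toReal_iff' (Lp.memLp _).2.ne (Lp.memLp _).2.ne).1 h

/-! ### Unique continuation for compactly supported solutions -/

section

variable {n : ℕ} {V u : EuclideanSpace ℝ (Fin n) → ℝ} {R : ℝ}

theorem memLp_of_ae_bound_of_ae_eq_zero {f : EuclideanSpace ℝ (Fin n) → ℂ}
    (hf : AEStronglyMeasurable f volume) {C : ℝ} (hC : ∀ᵐ x, ‖f x‖ ≤ C)
    (hR : ∀ᵐ x, R < ‖x‖ → f x = 0) (p : ENNReal) : MemLp f p := by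
  have h : f =ᵐ[volume] (closedBall 0 R).indicator f := by
    filter_upwards [hR] with x hx
    by_cases hxR : x ∈ closedBall 0 R
    · rw [indicator_of_mem hxR]
    · rw [indicator_of_notMem hxR, hx (by simpa using hxR)]
  rw [memLp_congr_ae h, memLp_indicator_iff_restrict measurableSet_closedBall]
  have : IsFiniteMeasure (volume.restrict (closedBall (0 : EuclideanSpace ℝ (Fin n)) R)) :=
    ⟨by simpa using measure_closedBall_lt_top⟩
  exact MemLp.of_bound hf.restrict C (ae_restrict_of_ae hC)

theorem integrable_ofReal_mul_of_ae_eq_zero {f : EuclideanSpace ℝ (Fin n) → ℝ}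
    (hf : LocallyIntegrable f volume) (hR : ∀ᵐ x, R < ‖x‖ → f x = 0)
    {g : EuclideanSpace ℝ (Fin n) → ℂ} (hg : Continuous g) :
    Integrable fun x => (f x : ℂ) * g x := by
  have h : IntegrableOn (fun x => (f x : ℂ) * g x) (closedBall 0 R) :=
    IntegrableOn.mul_continuousOn
      (hf.integrableOn_isCompact (isCompact_closedBall 0 R)).ofReal
      hg.continuousOn (isCompact_closedBall 0 R)
  refine h.integrable_of_ae_notMem_eq_zero ?_
  filter_upwards [hR] with x hx hxR
  rw [hx (by simpa using hxR)]
  simp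

/-- A compactly supported solution may be tested against any smooth function. -/
theorem IsWeakSolution.weak_eq_of_ae_eq_zero (hu : IsWeakSolution V u) (hR0 : 0 < R)
    (hR : ∀ᵐ x, R < ‖x‖ → u x = 0) {ψ : EuclideanSpace ℝ (Fin n) → ℝ} (hψ : ContDiff ℝ ∞ ψ) :
    -(∫ x, u x * Laplacian.laplacian ψ x) = ∫ x, V x * u x * ψ x := by
  -- The cutoff is `1` on a neighbourhood of the closed ball of radius `R`, so the Laplacian does
  -- not see it there.
  let χ : ContDiffBump (0 : EuclideanSpace ℝ (Fin n)) := ⟨R + 1, R + 2, by linarith, by linarith⟩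
  have h := hu.weak_eq (fun x => χ x * ψ x) (χ.contDiff.mul hψ) χ.hasCompactSupport.mul_right
  have h1 : ∀ x, ‖x‖ ≤ R → (fun x => χ x * ψ x) =ᶠ[𝓝 x] ψ := fun x hx => by
    filter_upwards [isOpen_ball.mem_nhds (mem_ball_zero_iff.2 (by linarith : ‖x‖ < R + 1))]
      with y hy
    rw [χ.one_of_mem_closedBall (ball_subset_closedBall hy), one_mul]
  have e1 : ∫ x, u x * Laplacian.laplacian (fun x => χ x * ψ x) x =
      ∫ x, u x * Laplacian.laplacian ψ x := by
    refine integral_congr_ae ?_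
    filter_upwards [hR] with x hx
    rcases lt_or_ge R ‖x‖ with hlt | hle
    · simp [hx hlt]
    · rw [(InnerProductSpace.laplacian_congr_nhds (h1 x hle)).eq_of_nhds]
  have e2 : ∫ x, V x * u x * (χ x * ψ x) = ∫ x, V x * u x * ψ x := by
    refine integral_congr_ae ?_
    filter_upwards [hR] with x hx
    rcases lt_or_ge R ‖x‖ with hlt | hle
    · simp [hx hlt]
    · rw [show χ x * ψ x = ψ x from (h1 x hle).eq_of_nhds]
  rw [e1, e2] at h
  exact h

/-- Testing a compactly supported solution against an exponential. -/
theorem IsWeakSolution.integral_cexp (hu : IsWeakSolution V u) (hR0 : 0 < R)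
    (hR : ∀ᵐ x, R < ‖x‖ → u x = 0) (ℓ : EuclideanSpace ℝ (Fin n) →L[ℝ] ℂ) :
    -((∑ i, ℓ (EuclideanSpace.single i 1) ^ 2) * ∫ x, (u x : ℂ) * Complex.exp (ℓ x)) =
      ∫ x, ((V x * u x : ℝ) : ℂ) * Complex.exp (ℓ x) := by
  have hexp : ContDiff ℝ ∞ fun x => Complex.exp (ℓ x) := ℓ.contDiff.cexp
  have hexp2 : ContDiff ℝ 2 fun x => Complex.exp (ℓ x) := ℓ.contDiff.cexp
  have hVR : ∀ᵐ x, R < ‖x‖ → V x * u x = 0 := by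
    filter_upwards [hR] with x hx hxR
    rw [hx hxR, mul_zero]
  have hi1 := integrable_ofReal_mul_of_ae_eq_zero hu.locallyIntegrable hR hexp.continuous
  have hi2 := integrable_ofReal_mul_of_ae_eq_zero hu.locallyIntegrable_mul hVR hexp.continuous
  set σ : ℂ := ∑ i, ℓ (EuclideanSpace.single i 1) ^ 2 with hσ
  -- Test functions are real, so the complex identity is obtained through real-linear functionals,
  -- then read off from real and imaginary parts.
  have key : ∀ l : ℂ →L[ℝ] ℝ, l (-(σ * ∫ x, (u x : ℂ) * Complex.exp (ℓ x))) =
      l (∫ x, ((V x * u x : ℝ) : ℂ) * Complex.exp (ℓ x)) := fun l => by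
    have h := hu.weak_eq_of_ae_eq_zero hR0 hR (l.contDiff.comp hexp)
    have h2 : ∀ x, Laplacian.laplacian (l ∘ fun x => Complex.exp (ℓ x)) x =
        l (σ * Complex.exp (ℓ x)) := fun x => by
      rw [hexp2.contDiffAt.laplacian_CLM_comp_left]
      rw [Function.comp_apply, laplacian_cexp_clm]
    have h3 : ∀ (a : ℝ) (z : ℂ), a * l z = l ((a : ℂ) * z) := fun a z => by
      rw [← smul_eq_mul, ← map_smul, Complex.real_smul]
    simp only [h2, Function.comp_apply, h3] at h
    have hi1' : Integrable fun x => (u x : ℂ) * (σ * Complex.exp (ℓ x)) :=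
      (hi1.const_mul σ).congr (Eventually.of_forall fun x => by ring)
    rw [l.integral_comp_comm hi1', l.integral_comp_comm hi2, ← map_neg] at h
    rw [← h, ← integral_const_mul]
    congr 2
    exact integral_congr_ae (Eventually.of_forall fun x => by ring)
  exact Complex.ext (key Complex.reCLM) (key Complex.imCLM)

end

section

variable {n : ℕ} {V u : EuclideanSpace ℝ (Fin n) → ℝ} {R : ℝ}

open FourierTransform in
/-- The Fourier transform of an exponentially weighted function. -/
theorem fourier_mul_exp_inner (f : EuclideanSpace ℝ (Fin n) → ℝ) (a ξ : EuclideanSpace ℝ (Fin n)) :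
    𝓕 (fun x => (f x : ℂ) * Complex.exp ((inner ℝ a x : ℝ) : ℂ)) ξ =
      ∫ x, (f x : ℂ) * Complex.exp ((Complex.ofRealCLM ∘L innerSL ℝ a +
        (-(2 * Real.pi) * Complex.I : ℂ) • (Complex.ofRealCLM ∘L innerSL ℝ ξ)) x) := by
  rw [Real.fourier_eq']
  refine integral_congr_ae (Eventually.of_forall fun x => ?_)
  simp only [smul_eq_mul, add_apply, smul_apply, ContinuousLinearMap.comp_apply,
    innerSL_apply_apply, Complex.ofRealCLM_apply, Complex.exp_add]
  rw [real_inner_comm]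
  push_cast
  rw [show -(2 * (Real.pi : ℂ)) * Complex.I * ((inner ℝ ξ x : ℝ) : ℂ) =
    -2 * Real.pi * ((inner ℝ ξ x : ℝ) : ℂ) * Complex.I by ring]
  ring

open FourierTransform in
/-- The Carleman-type lower bound for the conjugated Laplacian on the Fourier side. -/
theorem IsWeakSolution.abs_inner_mul_norm_fourier_le (hu : IsWeakSolution V u) (hR0 : 0 < R)
    (hR : ∀ᵐ x, R < ‖x‖ → u x = 0) (a ξ : EuclideanSpace ℝ (Fin n)) :
    4 * Real.pi * |inner ℝ a ξ| *
        ‖𝓕 (fun x => (u x : ℂ) * Complex.exp ((inner ℝ a x : ℝ) : ℂ)) ξ‖ ≤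
      ‖𝓕 (fun x => ((V x * u x : ℝ) : ℂ) * Complex.exp ((inner ℝ a x : ℝ) : ℂ)) ξ‖ := by
  rw [fourier_mul_exp_inner, fourier_mul_exp_inner (fun x => V x * u x), ← hu.integral_cexp hR0 hR,
    norm_neg, norm_mul]
  refine mul_le_mul_of_nonneg_right ?_ (norm_nonneg _)
  refine le_trans (le_of_eq ?_) (Complex.abs_im_le_norm _)
  -- The symbol is `∑ (aᵢ - 2πi ξᵢ)²`; only its imaginary part `-4π a·ξ` is kept.
  have h1 : ∀ i : Fin n, ((Complex.ofRealCLM ∘L innerSL ℝ a +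
        (-(2 * Real.pi) * Complex.I : ℂ) • (Complex.ofRealCLM ∘L innerSL ℝ ξ))
          (EuclideanSpace.single i 1) ^ 2).im = -(4 * Real.pi) * (a i * ξ i) := fun i => by
    simp only [add_apply, smul_apply, ContinuousLinearMap.comp_apply,
      innerSL_apply_apply, Complex.ofRealCLM_apply, EuclideanSpace.inner_single_right]
    simp [pow_two]
    ring
  have h2 : inner ℝ a ξ = ∑ i, a i * ξ i := by
    rw [PiLp.inner_apply]
    exact Finset.sum_congr rfl fun i _ => by simp [mul_comm]
  rw [Complex.im_sum, Finset.sum_congr rfl fun i _ => h1 i, ← Finset.mul_sum, ← h2, abs_mul, abs_neg,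
    abs_of_pos (by positivity : 0 < 4 * Real.pi)]

open FourierTransform in
-- Translation multiplies the transform by `e^{2πi a·ξ}`, and `|e^{iθ} - 1| ≤ |θ|`. The factor
-- `|a·ξ|` matches the Carleman bound, so no division by it is needed.
theorem norm_fourier_translate_sub_le {f : EuclideanSpace ℝ (Fin n) → ℂ} (hf : Integrable f)
    (a ξ : EuclideanSpace ℝ (Fin n)) :
    ‖𝓕 (fun x => f (x + a) - f x) ξ‖ ≤ 2 * Real.pi * |inner ℝ a ξ| * ‖𝓕 f ξ‖ := by
  have h1 : 𝓕 (fun x => f (x + a)) ξ = Real.fourierChar (inner ℝ a ξ) • 𝓕 f ξ :=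
    congrFun (VectorFourier.fourierIntegral_comp_add_right Real.fourierChar volume
      (innerₗ (EuclideanSpace ℝ (Fin n))) f a) ξ
  have h2 : 𝓕 (fun x => f (x + a) - f x) ξ = 𝓕 (fun x => f (x + a)) ξ - 𝓕 f ξ := by
    simp only [Real.fourier_eq, smul_sub]
    exact integral_sub ((Real.fourierIntegral_convergent_iff ξ).2 (hf.comp_add_right a))
      ((Real.fourierIntegral_convergent_iff ξ).2 hf)
  rw [h2, h1, Circle.smul_def, smul_eq_mul, ← sub_one_mul, norm_mul]
  refine mul_le_mul_of_nonneg_right ?_ (norm_nonneg _)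
  rw [Real.fourierChar_apply, mul_comm _ Complex.I]
  refine Real.norm_exp_I_mul_ofReal_sub_one_le.trans (le_of_eq ?_)
  rw [Real.norm_eq_abs, abs_mul, abs_of_pos (by positivity)]

/-- A bounded solution that vanishes near infinity vanishes identically. -/
theorem IsWeakSolution.ae_eq_zero_of_ae_eq_zero_near_infinity (hn : 1 ≤ n) (hV : IsLinftyLoc V)
    (hub : MemLp u ⊤ volume) (hu : IsWeakSolution V u) (hR0 : 0 < R)
    (hR : ∀ᵐ x, R < ‖x‖ → u x = 0) : u =ᵐ[volume] 0 := by
  obtain ⟨M, hM0, hM⟩ : ∃ M : ℝ, 0 < M ∧ ∀ᵐ x, ‖x‖ ≤ R → |V x| ≤ M := by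
    have h := (hV.2 (closedBall 0 R) (isCompact_closedBall 0 R))
    refine ⟨(eLpNormEssSup V (volume.restrict (closedBall 0 R))).toReal + 1, by positivity, ?_⟩
    have h1 := ae_le_eLpNormEssSup (f := V) (μ := volume.restrict (closedBall 0 R))
    rw [ae_restrict_iff' measurableSet_closedBall] at h1
    have hfin : eLpNormEssSup V (volume.restrict (closedBall 0 R)) ≠ ⊤ := by
      simpa using h.2.ne
    filter_upwards [h1] with x hx hxR
    have h2 := ENNReal.toReal_mono hfin (hx (by simpa using hxR))
    rw [toReal_enorm, Real.norm_eq_abs] at h2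
    linarith
  obtain ⟨A, hA⟩ : ∃ A : ℝ, ∀ᵐ x, |u x| ≤ A := by
    have hfin : eLpNormEssSup u volume ≠ ⊤ := by simpa using hub.2.ne
    refine ⟨(eLpNormEssSup u volume).toReal, ?_⟩
    filter_upwards [ae_le_eLpNormEssSup (f := u) (μ := volume)] with x hx
    have h2 := ENNReal.toReal_mono hfin hx
    rwa [toReal_enorm, Real.norm_eq_abs] at h2
  set e : EuclideanSpace ℝ (Fin n) := EuclideanSpace.single ⟨0, hn⟩ 1 with he
  have hen : ‖e‖ = 1 := by simp [he]
  -- Exceeds the diameter `2R`, so translating by `b` makes the supports disjoint.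
  set b : ℝ := 2 * R + 1 with hb
  have hb0 : 0 < b := by linarith
  -- Makes the ratio `2πb / (4πτ)` equal to `1 / (2M)`; together with `|q| ≤ M |v|` this yields the
  -- contraction factor `1/2`.
  set τ : ℝ := b * M with hτ
  have hτ0 : 0 < τ := by positivity
  set v : EuclideanSpace ℝ (Fin n) → ℂ :=
    fun x => (u x : ℂ) * Complex.exp ((inner ℝ (τ • e) x : ℝ) : ℂ) with hv
  set q : EuclideanSpace ℝ (Fin n) → ℂ :=
    fun x => ((V x * u x : ℝ) : ℂ) * Complex.exp ((inner ℝ (τ • e) x : ℝ) : ℂ) with hq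
  set w : EuclideanSpace ℝ (Fin n) → ℂ := fun x => v (x + b • e) - v x with hw
  have hexpc : Continuous fun x : EuclideanSpace ℝ (Fin n) =>
      Complex.exp ((inner ℝ (τ • e) x : ℝ) : ℂ) := by fun_prop
  have hvm : AEStronglyMeasurable v volume :=
    (Complex.continuous_ofReal.comp_aestronglyMeasurable hub.1).mul hexpc.aestronglyMeasurable
  have hqm : AEStronglyMeasurable q volume :=
    (Complex.continuous_ofReal.comp_aestronglyMeasurable (hV.1.mul hub.1)).mul
      hexpc.aestronglyMeasurable
  have hvR : ∀ᵐ x, R < ‖x‖ → v x = 0 := by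
    filter_upwards [hR] with x hx hxR
    simp [hv, hx hxR]
  have hqR : ∀ᵐ x, R < ‖x‖ → q x = 0 := by
    filter_upwards [hR] with x hx hxR
    simp [hq, hx hxR]
  have hqv : ∀ᵐ x, ‖q x‖ ≤ M * ‖v x‖ := by
    filter_upwards [hM, hqR] with x hx hx'
    rcases lt_or_ge R ‖x‖ with hlt | hle
    · rw [hx' hlt, norm_zero]
      positivity
    · simp only [hq, hv, norm_mul, Complex.ofReal_mul, Complex.norm_real, Real.norm_eq_abs, mul_assoc]
      gcongr
      exact hx hle
  have hvb : ∀ᵐ x, ‖v x‖ ≤ A * Real.exp (τ * R) := by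
    filter_upwards [hA, hvR] with x hx hx'
    have hA0 : 0 ≤ A := (abs_nonneg _).trans hx
    rcases lt_or_ge R ‖x‖ with hlt | hle
    · rw [hx' hlt, norm_zero]
      positivity
    · simp only [hv, norm_mul, Complex.norm_real, Real.norm_eq_abs, Complex.norm_exp_ofReal]
      gcongr
      refine (real_inner_le_norm _ _).trans ?_
      rw [norm_smul, hen, Real.norm_of_nonneg hτ0.le, mul_one]
      gcongr
  have hqb : ∀ᵐ x, ‖q x‖ ≤ M * (A * Real.exp (τ * R)) := by
    filter_upwards [hqv, hvb] with x h1 h2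
    exact h1.trans (by gcongr)
  have hv2 := memLp_of_ae_bound_of_ae_eq_zero hvm hvb hvR 2
  have hv1 := memLp_one_iff_integrable.1 (memLp_of_ae_bound_of_ae_eq_zero hvm hvb hvR 1)
  have hq2 := memLp_of_ae_bound_of_ae_eq_zero hqm hqb hqR 2
  have hq1 := memLp_one_iff_integrable.1 (memLp_of_ae_bound_of_ae_eq_zero hqm hqb hqR 1)
  have hmp := measurePreserving_add_right (volume : Measure (EuclideanSpace ℝ (Fin n))) (b • e)
  have hw1 : Integrable w := (hv1.comp_add_right _).sub hv1
  have hw2 : MemLp w 2 := (hv2.comp_measurePreserving hmp).sub hv2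
  have hvw : ∀ᵐ x, ‖v x‖ ≤ ‖w x‖ := by
    filter_upwards [hvR, hmp.quasiMeasurePreserving.ae hvR] with x h1 h2
    rcases lt_or_ge R ‖x‖ with hlt | hle
    · simp [h1 hlt]
    · have h3 : R < ‖x + b • e‖ := by
        have h4 := norm_sub_le (x + b • e) x
        rw [add_sub_cancel_left, norm_smul, hen, Real.norm_of_nonneg hb0.le] at h4
        linarith
      simp [hw, h2 h3]
  have hwq : ∀ ξ, ‖FourierTransform.fourier w ξ‖ ≤ (2 * M)⁻¹ * ‖FourierTransform.fourier q ξ‖ := by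
    intro ξ
    have h1 := norm_fourier_translate_sub_le hv1 (b • e) ξ
    have h2 := hu.abs_inner_mul_norm_fourier_le hR0 hR (τ • e) ξ
    rw [inner_smul_left, abs_mul] at h1 h2
    simp only [conj_trivial, abs_of_pos hb0, abs_of_pos hτ0] at h1 h2
    refine h1.trans ?_
    rw [inv_mul_eq_div, le_div_iff₀ (by positivity)]
    refine le_trans (le_of_eq ?_) h2
    rw [hτ]
    ring
  have hfin : eLpNorm v 2 volume ≤ ENNReal.ofReal 2⁻¹ * eLpNorm v 2 volume := by
    calc eLpNorm v 2 volume ≤ eLpNorm w 2 volume := eLpNorm_mono_ae hvw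
      _ = eLpNorm (FourierTransform.fourier w) 2 volume := (eLpNorm_fourier_eq hw1 hw2).symm
      _ ≤ ENNReal.ofReal (2 * M)⁻¹ * eLpNorm (FourierTransform.fourier q) 2 volume :=
        eLpNorm_le_mul_eLpNorm_of_ae_le_mul (Eventually.of_forall hwq) 2
      _ = ENNReal.ofReal (2 * M)⁻¹ * eLpNorm q 2 volume := by rw [eLpNorm_fourier_eq hq1 hq2]
      _ ≤ ENNReal.ofReal (2 * M)⁻¹ * (ENNReal.ofReal M * eLpNorm v 2 volume) := by
        gcongr
        exact eLpNorm_le_mul_eLpNorm_of_ae_le_mul hqv 2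
      _ = ENNReal.ofReal 2⁻¹ * eLpNorm v 2 volume := by
        rw [← mul_assoc, ← ENNReal.ofReal_mul (by positivity)]
        congr 2
        field_simp
  have hzero : eLpNorm v 2 volume = 0 := by
    by_contra hne
    have hreal := ENNReal.toReal_mono (ENNReal.mul_ne_top ENNReal.ofReal_ne_top hv2.2.ne) hfin
    rw [ENNReal.toReal_mul, ENNReal.toReal_ofReal (by norm_num)] at hreal
    have := ENNReal.toReal_pos hne hv2.2.ne
    linarith
  rw [eLpNorm_eq_zero_iff hvm two_ne_zero] at hzero
  filter_upwards [hzero] with x hx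
  simpa [hv] using hx

/-! ### The main theorem -/

theorem IsWeakSolution.neg (hu : IsWeakSolution V u) : IsWeakSolution V (-u) where
  locallyIntegrable := hu.locallyIntegrable.neg
  locallyIntegrable_mul := by
    have h := hu.locallyIntegrable_mul.neg
    refine h.congr (Eventually.of_forall fun x => ?_)
    simp
  weak_eq φ hφ hφs := by
    have h := hu.weak_eq φ hφ hφs
    simp only [Pi.neg_apply, neg_mul, mul_neg, integral_neg, h]

end

/- The integrals of the nonnegative functions `1 / (|x|^(n+2) V)` and `|x|^(4-2n) V` are taken in
`[0, ∞]`, where `1 / 0 = ∞`. -/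
theorem theorem1p4 (n : ℕ) (hn : 1 ≤ n) (V : EuclideanSpace ℝ (Fin n) → ℝ) (hV : IsLinftyLoc V)
    (r : ℝ) (hr : 0 < r) (hV_nonneg : ∀ᵐ x, r < ‖x‖ → 0 ≤ V x)
    (hV_inv : (∫⁻ x in {x : EuclideanSpace ℝ (Fin n) | r < ‖x‖},
      1 / ENNReal.ofReal (‖x‖ ^ (n + 2) * V x)) < ⊤)
    (hV_int : (∫⁻ x in {x : EuclideanSpace ℝ (Fin n) | r < ‖x‖},
      ENNReal.ofReal (‖x‖ ^ (4 - 2 * (n : ℤ)) * V x)) = ⊤) :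
    (∀ u : EuclideanSpace ℝ (Fin n) → ℝ, MemLp u ⊤ volume → IsWeakSolution V u →
      NonnegNearInfinity u ∨ NonposNearInfinity u → u =ᵐ[volume] 0) ∧
    (∀ u : EuclideanSpace ℝ (Fin n) → ℝ, MemLp u ⊤ volume → IsWeakSolution V u →
      (¬ ∃ c : ℝ, u =ᵐ[volume] fun _ => c) → ChangesSignNearInfinity u) := by
  have hnonneg : ∀ u : EuclideanSpace ℝ (Fin n) → ℝ, MemLp u ⊤ volume → IsWeakSolution V u →
      NonnegNearInfinity u → u =ᵐ[volume] 0 := fun u hub hu hpos => by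
    obtain ⟨R, hR0, hR⟩ := hu.exists_ae_eq_zero_of_nonneg hr hV hV_inv hpos
    exact hu.ae_eq_zero_of_ae_eq_zero_near_infinity hn hV hub hR0 hR
  have hmain : ∀ u : EuclideanSpace ℝ (Fin n) → ℝ, MemLp u ⊤ volume → IsWeakSolution V u →
      NonnegNearInfinity u ∨ NonposNearInfinity u → u =ᵐ[volume] 0 := by
    rintro u hub hu (hpos | ⟨R, hR⟩)
    · exact hnonneg u hub hu hpos
    · have h := hnonneg (-u) hub.neg hu.neg ⟨R, by
        filter_upwards [hR] with x hx hxR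
        simpa using hx hxR⟩
      filter_upwards [h] with x hx
      simpa using hx
  refine ⟨hmain, fun u hub hu hc R => ⟨?_, ?_⟩⟩
  -- If the set is null, `u` has one sign near infinity, hence is zero by the first part,
  -- contradicting nonconstancy.
  · refine pos_iff_ne_zero.2 fun h0 => hc ⟨0, hmain u hub hu (Or.inr ⟨R, ?_⟩)⟩
    rw [ae_iff]
    simpa only [Classical.not_imp, not_le] using h0
  · refine pos_iff_ne_zero.2 fun h0 => hc ⟨0, hmain u hub hu (Or.inl ⟨R, ?_⟩)⟩
    rw [ae_iff]
    simpa only [Classical.not_imp, not_le] using h0
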